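/- Throughout, a measure is a Borel probability measure on $\mathbb{R}$ with infinite support and finite moments of all orders. Call a measure $\psi$ natural if it is determined by its moments (among measures on $\mathbb{R}$) or if, its moment problem being indeterminate, its support is bounded below and has the largest possible infimum among the supports of all measures with the same moments. A rate set is a pair of real sequences $(\lambda_n)_{n\ge0},(\mu_n)_{n\ge0}$ with $\mu_0\ge0$ and $\lambda_n>0$, $\mu_{n+1}>0$ for $n\ge 0$. It is a rate set of the measure $\chi$ if the monic orthogonal polynomials $P_n$ of $\chi$ satisfy $P_0=1$, $P_1(x)=x-\lambda_0-\mu_0$ and $$P_n(x)=(x-\lambda_{n-1}-\mu_{n-1})P_{n-1}(x)-\lambda_{n-2}\mu_{n-1}P_{n-2}(x),\qquad n>1.$$ Let $\psi$ be a natural measure on $[0,\infty)$ with $m_{-1}(\psi):=\int_{[0,\infty)}x^{-1}\,\psi(dx)<\infty$. For $0\le a<\infty$ let $$\phi^{(0)}(dx):=\frac{1}{m_{-1}(\psi)}\,x^{-1}\,\psi(dx),\qquad \phi^{(a)}:=\frac{1}{a+1}\bigl(a\delta_0+\phi^{(0)}\bigr).$$ **Theorem.** 1. For every $0\le a<\infty$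 the measure $\phi^{(a)}$ has exactly one rate set $\{\lambda_n^{(a)},\mu_n^{(a)}\}$ with $\mu_0^{(a)}=0$, and the limits $\lambda_n^{(\infty)}:=\lim_{a\to\infty}\lambda_n^{(a)}$, $\mu_n^{(\infty)}:=\lim_{a\to\infty}\mu_n^{(a)}$ exist for all $n\ge0$. Thus each $a\in[0,\infty]$ determines sequences $\lambda_n:=\mu_{n+1}^{(a)}$, $\mu_n:=\lambda_n^{(a)}$ $(n\ge0)$. 2. For each $a\in[0,\infty]$, $\{\lambda_n,\mu_n\}$ is a rate set of $\psi$ and $$\mu_0=\frac{1}{(a+1)\,m_{-1}(\psi)},$$ where the right-hand side is $0$ for $a=\infty$. 3. As $a$ ranges over $[0,\infty]$, the set of values of $\mu_0$ is exactly the interval $[0,1/m_{-1}(\psi)]$. -/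

import Mathlib

open MeasureTheory Filter Topology Polynomial
open scoped NNReal ENNReal

namespace BirthDeath

/-- The measures considered: Borel probability measures on the real line with infinite support
and finite moments of all orders. -/
structure IsMomentMeasure (ψ : Measure ℝ) : Prop where
  isProbabilityMeasure : IsProbabilityMeasure ψ
  infinite_support : ψ.support.Infinite
  integrable_pow : ∀ n : ℕ, Integrable (fun x : ℝ => x ^ n) ψ

/-- `ν` solves the Hamburger moment problem associated with `ψ`. -/
def SameMoments (ψ ν : Measure ℝ) : Prop :=
  IsMomentMeasure ν ∧ ∀ n : ℕ, ∫ x, x ^ n ∂ν = ∫ x, x ^ n ∂ψ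

/-- The Hamburger moment problem associated with `ψ` is determined. -/
def IsDetH (ψ : Measure ℝ) : Prop :=
  ∀ ν : Measure ℝ, SameMoments ψ ν → ν = ψ

/-- The infimum of the support (it is `⊥` if the support is not bounded below). -/
noncomputable def leftEnd (ψ : Measure ℝ) : EReal :=
  sInf ((fun x : ℝ => (x : EReal)) '' ψ.support)

/-- `ψ` is natural: its Hamburger moment problem is determined or, if it is indeterminate,
`ψ` has left-bounded support and, among all solutions, the infimum of its support is maximal.
(A measure on `[0, ∞)` whose Stieltjes problem is determined is covered: every other
solution of the Hamburger problem then charges the negative half-line.) -/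
def IsNatural (ψ : Measure ℝ) : Prop :=
  IsDetH ψ ∨
    (¬ IsDetH ψ ∧ BddBelow ψ.support ∧ ∀ ν : Measure ℝ, SameMoments ψ ν → leftEnd ν ≤ leftEnd ψ)

/-- The moment of order `-1`, `∫_{[0,∞)} x⁻¹ ψ(dx) ∈ [0, ∞]`, where `1 / 0 = ∞`. -/
noncomputable def mNegOne (ψ : Measure ℝ) : ℝ≥0∞ :=
  ∫⁻ x in Set.Ici 0, (ENNReal.ofReal x)⁻¹ ∂ψ

/-- `φ⁽⁰⁾(dx) = x⁻¹ ψ(dx) / m₋₁(ψ)` on `[0, ∞)`. -/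
noncomputable def phiZero (ψ : Measure ℝ) : Measure ℝ :=
  (mNegOne ψ)⁻¹ • (ψ.restrict (Set.Ici 0)).withDensity (fun x => (ENNReal.ofReal x)⁻¹)

/-- `φ⁽ᵃ⁾ = (a δ₀ + φ⁽⁰⁾) / (a + 1)`. -/
noncomputable def phi (ψ : Measure ℝ) (a : ℝ≥0) : Measure ℝ :=
  ((a : ℝ≥0∞) + 1)⁻¹ • ((a : ℝ≥0∞) • Measure.dirac (0 : ℝ) + phiZero ψ)

/-- `P` is the sequence of monic orthogonal polynomials with respect to `ψ`. -/
structure IsMonicOPS (ψ : Measure ℝ) (P : ℕ → ℝ[X]) : Prop where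
  monic : ∀ n, (P n).Monic
  natDegree_eq : ∀ n, (P n).natDegree = n
  orthogonal : ∀ m n, m ≠ n → ∫ x, (P m).eval x * (P n).eval x ∂ψ = 0

/-- A set of birth rates `lam n` and death rates `mu n`: all strictly positive, except that
`mu 0` may vanish. -/
structure IsRateSet (lam mu : ℕ → ℝ) : Prop where
  birth_pos : ∀ n, 0 < lam n
  death_zero_nonneg : 0 ≤ mu 0
  death_succ_pos : ∀ n, 0 < mu (n + 1)

/-- The three-term recurrence of `P` with coefficients given by birth and death rates:
`P₀ = 1`, `P₁ = x - λ₀ - μ₀`, `Pₙ = (x - λₙ₋₁ - μₙ₋₁) Pₙ₋₁ - λₙ₋₂ μₙ₋₁ Pₙ₋₂` for `n > 1`. -/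
structure SatisfiesRecurrence (P : ℕ → ℝ[X]) (lam mu : ℕ → ℝ) : Prop where
  zero : P 0 = 1
  one : P 1 = X - C (lam 0 + mu 0)
  step : ∀ n, P (n + 2) =
    (X - C (lam (n + 1) + mu (n + 1))) * P (n + 1) - C (lam n * mu (n + 1)) * P n

/-- `lam`, `mu` is a rate set representing the recurrence coefficients of the monic orthogonal
polynomials with respect to `ψ`. -/
def IsRateSetOf (ψ : Measure ℝ) (lam mu : ℕ → ℝ) : Prop :=
  IsRateSet lam mu ∧ ∃ P : ℕ → ℝ[X], IsMonicOPS ψ P ∧ SatisfiesRecurrence P lam mu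

/-- `lamA`, `muA` are the rates `λₙ⁽ᵃ⁾`, `μₙ⁽ᵃ⁾`, normalized by `μ₀⁽ᵃ⁾ = 0`, in the recurrence of
the shell polynomials, i.e. the monic orthogonal polynomials with respect to `φ⁽ᵃ⁾`. -/
def IsShellRates (ψ : Measure ℝ) (a : ℝ≥0) (lamA muA : ℕ → ℝ) : Prop :=
  IsRateSetOf (phi ψ a) lamA muA ∧ muA 0 = 0

/-- `lamA`, `muA` are the limits `λₙ⁽^∞⁾`, `μₙ⁽^∞⁾` of `λₙ⁽ᵃ⁾`, `μₙ⁽ᵃ⁾` as `a → ∞`. -/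
def IsShellRatesLimit (ψ : Measure ℝ) (lamA muA : ℕ → ℝ) : Prop :=
  ∃ L M : ℝ≥0 → ℕ → ℝ, (∀ a, IsShellRates ψ a (L a) (M a)) ∧
    ∀ n, Tendsto (fun a => L a n) atTop (𝓝 (lamA n)) ∧
      Tendsto (fun a => M a n) atTop (𝓝 (muA n))

/-- `lamA`, `muA` are the rates `λₙ⁽ᵃ⁾`, `μₙ⁽ᵃ⁾`, for `0 ≤ a ≤ ∞`. -/
def IsExtShellRates (ψ : Measure ℝ) (a : ℝ≥0∞) (lamA muA : ℕ → ℝ) : Prop :=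
  (∃ b : ℝ≥0, a = b ∧ IsShellRates ψ b lamA muA) ∨ (a = ⊤ ∧ IsShellRatesLimit ψ lamA muA)

/-- The rates `lam`, `mu` are determined by the parameter `a ∈ [0, ∞]`: they arise from the rates
of the shell polynomials through the dual correspondence `λₙ = μₙ₊₁⁽ᵃ⁾`, `μₙ = λₙ⁽ᵃ⁾`. -/
def IsDeterminedBy (ψ : Measure ℝ) (a : ℝ≥0∞) (lam mu : ℕ → ℝ) : Prop :=
  ∃ lamA muA : ℕ → ℝ, IsExtShellRates ψ a lamA muA ∧
    (∀ n, lam n = muA (n + 1)) ∧ ∀ n, mu n = lamA n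

end BirthDeath

/-! The factor `x` kills the atom of `φ⁽ᵃ⁾` at `0`, so `x φ⁽ᵃ⁾(dx) = c ψ(dx)` with `c = 1 / ((a + 1)
m₋₁)`. Hence the orthogonal polynomials `T n` of `ψ` are the kernel polynomials of the orthogonal
polynomials `S n` of `φ⁽ᵃ⁾`, and the two are linked by `X * T n = S (n + 1) + λₙ S n` and `S (n + 1)
= T (n + 1) + μₙ₊₁ T n` with positive coefficients (`X_mul_eq_add`, `eq_add_of_isOrthPoly_mulX`).
Eliminating `T` gives the shell recurrence with `μ₀ = 0`; eliminating `S` gives the recurrence of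
`ψ` with birth and death rates interchanged (`exists_dual_rates`). Its initial death rate is `λ₀⁽ᵃ⁾
= c`.

The polynomials `T n` do not depend on `a`, and for a fixed recurrence all rates are determined by,
and continuous in, the initial death rate. As `a → ∞` this rate tends to `0`, so the limit is the
rate set of `ψ` with `μ₀ = 0`, which exists by the same factorization applied to `ψ` itself. -/

namespace BirthDeath

/-! ### Orthogonal polynomials of a positive definite functional and kernel polynomials -/

section Functional

variable {L : ℝ[X] →ₗ[ℝ] ℝ}

/-- A linear functional on real polynomials is positive definite if it is positive on the squares
of nonzero polynomials. -/
def IsPosDef (L : ℝ[X] →ₗ[ℝ] ℝ) : Prop :=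
  ∀ p : ℝ[X], p ≠ 0 → 0 < L (p * p)

/-- `p` is a monic polynomial of degree `n` which is orthogonal, with respect to `L`, to all
polynomials of smaller degree. -/
structure IsOrthPoly (L : ℝ[X] →ₗ[ℝ] ℝ) (n : ℕ) (p : ℝ[X]) : Prop where
  monic : p.Monic
  natDegree_eq : p.natDegree = n
  orthogonal : ∀ q : ℝ[X], q.degree < n → L (p * q) = 0

lemma IsOrthPoly.degree_eq {n : ℕ} {p : ℝ[X]} (hp : IsOrthPoly L n p) : p.degree = n := by
  rw [degree_eq_natDegree hp.monic.ne_zero, hp.natDegree_eq]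

lemma _root_.Polynomial.Monic.degree_sub_lt_of_natDegree_eq {p q : ℝ[X]} {n : ℕ} (hp : p.Monic)
    (hq : q.Monic) (hpn : p.natDegree = n) (hqn : q.natDegree = n) : (p - q).degree < n := by
  have h : p.degree = n := by rw [degree_eq_natDegree hp.ne_zero, hpn]
  rw [← h]
  refine degree_sub_lt_left ?_ hp.ne_zero (by rw [hp.leadingCoeff, hq.leadingCoeff])
  rw [h, degree_eq_natDegree hq.ne_zero, hqn]

lemma IsOrthPoly.apply_mul_monic {n : ℕ} {p q : ℝ[X]} (hp : IsOrthPoly L n p) (hq : q.Monic)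
    (hqn : q.natDegree = n) : L (p * q) = L (p * p) := by
  have h := hp.orthogonal _ (hq.degree_sub_lt_of_natDegree_eq hp.monic hqn hp.natDegree_eq)
  rw [mul_sub, map_sub] at h
  linarith

/-- Positive definite functionals admit monic orthogonal polynomials of every degree. -/
lemma IsPosDef.exists_isOrthPoly (hL : IsPosDef L) (n : ℕ) : ∃ p, IsOrthPoly L n p := by
  -- Positive definiteness makes the Gram form on degrees below `n` nondegenerate, so some `q` there
  -- represents `r ↦ L (X ^ n * r)`; then `X ^ n - q` is orthogonal.
  let B : degreeLT ℝ n →ₗ[ℝ] Module.Dual ℝ (degreeLT ℝ n) :=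
    ((LinearMap.mul ℝ ℝ[X]).compr₂ L).compl₁₂ (degreeLT ℝ n).subtype (degreeLT ℝ n).subtype
  have hB : Function.Injective B := by
    rw [injective_iff_map_eq_zero]
    intro p hp
    by_contra hne
    have h0 : L ((p : ℝ[X]) * p) = 0 := by simpa [B] using LinearMap.congr_fun hp p
    exact (hL p (by simpa using hne)).ne' h0
  have : FiniteDimensional ℝ (degreeLT ℝ n) :=
    Module.Finite.equiv (degreeLTEquiv ℝ n).symm
  have hsurj : Function.Surjective B :=
    (LinearMap.injective_iff_surjective_of_finrank_eq_finrank
      (Subspace.dual_finrank_eq).symm).1 hB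
  obtain ⟨q, hq⟩ := hsurj (((LinearMap.mul ℝ ℝ[X]).compr₂ L (X ^ n)).comp
    (degreeLT ℝ n).subtype)
  have hqd : (q : ℝ[X]).degree < n := mem_degreeLT.1 q.2
  refine ⟨X ^ n - (q : ℝ[X]), monic_X_pow_sub hqd, ?_, fun r hr => ?_⟩
  · refine natDegree_eq_of_degree_eq_some ?_
    rw [degree_sub_eq_left_of_degree_lt] <;> simp [hqd]
  · have h := LinearMap.congr_fun hq ⟨r, mem_degreeLT.2 hr⟩
    simp only [LinearMap.compl₁₂_apply, LinearMap.compr₂_apply, LinearMap.mul_apply', B,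
      LinearMap.comp_apply, Submodule.subtype_apply] at h
    rw [sub_mul, map_sub, h, sub_self]

lemma IsPosDef.eq_of_isOrthPoly (hL : IsPosDef L) {n : ℕ} {p q : ℝ[X]} (hp : IsOrthPoly L n p)
    (hq : IsOrthPoly L n q) : p = q := by
  by_contra hne
  have hd := hp.monic.degree_sub_lt_of_natDegree_eq hq.monic hp.natDegree_eq hq.natDegree_eq
  have h := hL (p - q) (sub_ne_zero.2 hne)
  rw [sub_mul, map_sub, hp.orthogonal _ hd, hq.orthogonal _ hd, sub_zero] at h
  exact h.false

/-- A polynomial of degree at most `n` orthogonal to those of degree less than `n` is a multiple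
of the monic orthogonal polynomial of degree `n`. -/
lemma IsPosDef.eq_C_mul (hL : IsPosDef L) {n : ℕ} {p r : ℝ[X]} (hp : IsOrthPoly L n p)
    (hr : r.degree < ((n + 1 : ℕ) : WithBot ℕ)) (horth : ∀ q : ℝ[X], q.degree < n → L (r * q) = 0) :
    r = C (L (r * p) / L (p * p)) * p := by
  have hdeg : (r - C (r.coeff n) * p).degree < n := by
    refine (degree_lt_iff_coeff_zero _ _).2 fun m hm => ?_
    rcases hm.eq_or_lt with rfl | hm
    · have := hp.monic.coeff_natDegree
      rw [hp.natDegree_eq] at this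
      simp [this]
    · rw [coeff_sub, coeff_C_mul, (degree_lt_iff_coeff_zero _ _).1 hr m hm,
        coeff_eq_zero_of_natDegree_lt (hp.natDegree_eq.trans_lt hm), mul_zero, sub_zero]
  have hzero : r - C (r.coeff n) * p = 0 := by
    by_contra hne
    have h := hL _ hne
    rw [sub_mul, map_sub, horth _ hdeg, mul_assoc, ← smul_eq_C_mul, map_smul,
      hp.orthogonal _ hdeg] at h
    simp at h
  have hr' : r = C (r.coeff n) * p := sub_eq_zero.1 hzero
  have hval : L (r * p) / L (p * p) = r.coeff n := by
    conv_lhs => rw [hr', mul_assoc, ← smul_eq_C_mul, map_smul, smul_eq_mul]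
    exact mul_div_cancel_right₀ _ (hL p hp.monic.ne_zero).ne'
  rw [hval, ← hr']

/-- The functional `p ↦ L (X * p)`. -/
noncomputable def mulX (L : ℝ[X] →ₗ[ℝ] ℝ) : ℝ[X] →ₗ[ℝ] ℝ :=
  L.comp (LinearMap.mulLeft ℝ X)

@[simp] lemma mulX_apply (p : ℝ[X]) : mulX L p = L (X * p) := rfl

/-- In `X * t - s'` the leading terms cancel, and both terms are `L`-orthogonal to degrees below
`n`, so only a multiple of `s` remains. Pairing with `s` gives the coefficient. -/
lemma X_mul_eq_add (hL : IsPosDef L) {n : ℕ} {s s' t : ℝ[X]} (hs : IsOrthPoly L n s)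
    (hs' : IsOrthPoly L (n + 1) s') (ht : IsOrthPoly (mulX L) n t) :
    X * t = s' + C (mulX L (t * t) / L (s * s)) * s := by
  have hXt : (X * t).Monic := monic_X.mul ht.monic
  have hXtn : (X * t).natDegree = n + 1 := by
    rw [natDegree_X_mul ht.monic.ne_zero, ht.natDegree_eq]
  have h := hL.eq_C_mul hs
    (hXt.degree_sub_lt_of_natDegree_eq hs'.monic hXtn hs'.natDegree_eq) (fun q hq => by
      have h1 := ht.orthogonal q hq
      rw [mulX_apply, ← mul_assoc] at h1
      rw [sub_mul, map_sub, h1, hs'.orthogonal q (hq.trans (by exact_mod_cast n.lt_succ_self)),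
        sub_zero])
  have hval : L ((X * t - s') * s) = mulX L (t * t) := by
    rw [sub_mul, map_sub, hs'.orthogonal s (by rw [hs.degree_eq]; exact_mod_cast n.lt_succ_self),
      sub_zero, mul_assoc, ← mulX_apply, ht.apply_mul_monic hs.monic hs.natDegree_eq]
  rw [hval] at h
  rw [← h]
  ring

/-- For `q` of degree below `n`, `X * q` has degree at most `n`, so `s'` is also `mulX L`-orthogonal
to `q`. Hence `s' - t'`, of degree at most `n`, is a multiple of `t`. -/
lemma eq_add_of_isOrthPoly_mulX (hL' : IsPosDef (mulX L)) {n : ℕ} {s' t t' : ℝ[X]}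
    (hs' : IsOrthPoly L (n + 1) s') (ht : IsOrthPoly (mulX L) n t)
    (ht' : IsOrthPoly (mulX L) (n + 1) t') :
    s' = t' + C (L (s' * s') / mulX L (t * t)) * t := by
  have hcomm (q : ℝ[X]) : mulX L (s' * q) = L (s' * (X * q)) := by
    rw [mulX_apply]; congr 1; ring
  have h := hL'.eq_C_mul ht
    (hs'.monic.degree_sub_lt_of_natDegree_eq ht'.monic hs'.natDegree_eq ht'.natDegree_eq)
    (fun q hq => by
      have hXq : (X * q).degree < ((n + 1 : ℕ) : WithBot ℕ) := by
        rw [degree_lt_iff_coeff_zero] at hq ⊢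
        intro m hm
        obtain ⟨k, rfl⟩ : ∃ k, m = k + 1 := ⟨m - 1, by omega⟩
        rw [coeff_X_mul, hq k (by omega)]
      rw [sub_mul, map_sub, ht'.orthogonal q (hq.trans (by exact_mod_cast n.lt_succ_self)),
        hcomm, hs'.orthogonal _ hXq, sub_zero])
  have hval : mulX L ((s' - t') * t) = L (s' * s') := by
    rw [sub_mul, map_sub, ht'.orthogonal t (by rw [ht.degree_eq]; exact_mod_cast n.lt_succ_self),
      sub_zero, hcomm, hs'.apply_mul_monic (monic_X.mul ht.monic)
        (by rw [natDegree_X_mul ht.monic.ne_zero, ht.natDegree_eq])]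
  rw [hval] at h
  rw [← h]
  ring

lemma IsOrthPoly.eq_one {p : ℝ[X]} (hp : IsOrthPoly L 0 p) : p = 1 :=
  hp.monic.natDegree_eq_zero.1 hp.natDegree_eq

/-- If `L` is positive definite on polynomials and on multiples of `X`, its orthogonal polynomials
have a representation by birth and death rates without killing, and the orthogonal polynomials of
`mulX L` are represented by the dual rates. -/
lemma exists_dual_rates (hL : IsPosDef L) (hL' : IsPosDef (mulX L)) {S T : ℕ → ℝ[X]}
    (hS : ∀ n, IsOrthPoly L n (S n)) (hT : ∀ n, IsOrthPoly (mulX L) n (T n)) :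
    ∃ lam mu : ℕ → ℝ, (∀ n, 0 < lam n) ∧ mu 0 = 0 ∧ (∀ n, 0 < mu (n + 1)) ∧
      lam 0 = L X / L 1 ∧ SatisfiesRecurrence S lam mu ∧
      SatisfiesRecurrence T (fun n => mu (n + 1)) lam := by
  have hXT (n) := X_mul_eq_add hL (hS n) (hS (n + 1)) (hT n)
  have hST (n) := eq_add_of_isOrthPoly_mulX hL' (hS (n + 1)) (hT n) (hT (n + 1))
  set lam : ℕ → ℝ := fun n => mulX L (T n * T n) / L (S n * S n) with hlam
  set mu : ℕ → ℝ := fun n => Nat.casesOn n 0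
    fun k => L (S (k + 1) * S (k + 1)) / mulX L (T k * T k) with hmu
  replace hXT (n) : X * T n = S (n + 1) + C (lam n) * S n := hXT n
  replace hST (n) : S (n + 1) = T (n + 1) + C (mu (n + 1)) * T n := hST n
  have hS0 := (hS 0).eq_one
  have hT0 := (hT 0).eq_one
  refine ⟨lam, mu, fun n => div_pos (hL' _ (hT n).monic.ne_zero) (hL _ (hS n).monic.ne_zero), rfl,
    fun n => div_pos (hL _ (hS _).monic.ne_zero) (hL' _ (hT n).monic.ne_zero), ?_,
    ⟨hS0, ?_, fun n => ?_⟩, ⟨hT0, ?_, fun n => ?_⟩⟩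
  · simp [hlam, hS0, hT0]
  · have h := hXT 0
    rw [hS0, hT0] at h
    have : mu 0 = 0 := rfl
    rw [this, add_zero]
    linear_combination -h
  -- Elimination of `T`.
  · rw [C_add, C_mul]
    linear_combination -hXT (n + 1) - C (mu (n + 1)) * hXT n - X * hST n
  · have h := hXT 0
    have h' := hST 0
    rw [hT0] at h h'
    rw [hS0] at h
    rw [C_add]
    linear_combination -h' - h
  -- Elimination of `S`.
  · rw [C_add, C_mul]
    linear_combination -hXT (n + 1) - hST (n + 1) - C (lam (n + 1)) * hST n

end Functional

/-! ### Rates as functions of the recurrence and the initial death rate -/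

section Recurrence

variable {P : ℕ → ℝ[X]} {lam mu lam' mu' : ℕ → ℝ}

lemma SatisfiesRecurrence.sum_zero_eq (h : SatisfiesRecurrence P lam mu)
    (h' : SatisfiesRecurrence P lam' mu') : lam 0 + mu 0 = lam' 0 + mu' 0 := by
  have := h.one.symm.trans h'.one
  exact C_injective (sub_right_injective this)

/-- The recurrence coefficients of a sequence of monic polynomials are unique. -/
lemma SatisfiesRecurrence.coeffs_eq (hP : ∀ n, (P n).Monic) (hdeg : ∀ n, (P n).natDegree = n)
    (h : SatisfiesRecurrence P lam mu) (h' : SatisfiesRecurrence P lam' mu') :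
    (∀ n, lam n + mu n = lam' n + mu' n) ∧
      ∀ n, lam n * mu (n + 1) = lam' n * mu' (n + 1) := by
  have key (n : ℕ) : lam (n + 1) + mu (n + 1) = lam' (n + 1) + mu' (n + 1) ∧
      lam n * mu (n + 1) = lam' n * mu' (n + 1) := by
    -- The difference of the two recurrences is a combination of `P (n + 1)` and `P n`, whose
    -- degrees differ, so both coefficients vanish.
    have e : C (lam (n + 1) + mu (n + 1) - (lam' (n + 1) + mu' (n + 1))) * P (n + 1) +
        C (lam n * mu (n + 1) - lam' n * mu' (n + 1)) * P n = 0 := by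
      rw [C_sub, C_sub]
      linear_combination h.step n - h'.step n
    have hc := congrArg (fun p => coeff p (n + 1)) e
    have h1 := (hP (n + 1)).coeff_natDegree
    rw [hdeg] at h1
    have h0 : (P n).coeff (n + 1) = 0 :=
      coeff_eq_zero_of_natDegree_lt (by rw [hdeg]; exact n.lt_succ_self)
    simp only [coeff_add, coeff_C_mul, h1, h0, coeff_zero, mul_one, mul_zero, add_zero] at hc
    rw [hc, C_0, zero_mul, zero_add] at e
    have hd := (mul_eq_zero.1 e).resolve_right (hP n).ne_zero
    exact ⟨sub_eq_zero.1 hc, sub_eq_zero.1 (C_eq_zero.1 hd)⟩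
  refine ⟨fun n => ?_, fun n => (key n).2⟩
  cases n with
  | zero => exact h.sum_zero_eq h'
  | succ n => exact (key n).1

/-- From `mu 0`, the sums `lam n + mu n` and the products `lam n * mu (n + 1)` yield the rates
alternately. -/
lemma SatisfiesRecurrence.rates_eq (hP : ∀ n, (P n).Monic) (hdeg : ∀ n, (P n).natDegree = n)
    (h : SatisfiesRecurrence P lam mu) (h' : SatisfiesRecurrence P lam' mu')
    (hpos : ∀ n, lam n ≠ 0) (h0 : mu 0 = mu' 0) : lam = lam' ∧ mu = mu' := by
  obtain ⟨hc, hd⟩ := h.coeffs_eq hP hdeg h'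
  have key (n : ℕ) : lam n = lam' n ∧ mu n = mu' n := by
    induction n with
    | zero => exact ⟨by linarith [hc 0], h0⟩
    | succ n ih =>
      have hm : mu (n + 1) = mu' (n + 1) := mul_left_cancel₀ (hpos n) (by rw [hd n, ih.1])
      exact ⟨by linarith [hc (n + 1)], hm⟩
  exact ⟨funext fun n => (key n).1, funext fun n => (key n).2⟩

/-- The rates in the recurrence of a fixed sequence of monic polynomials depend continuously on the
initial death rate. -/
lemma SatisfiesRecurrence.tendsto_rates {ι : Type*} {l : Filter ι} {A B : ι → ℕ → ℝ}
    (hP : ∀ n, (P n).Monic) (hdeg : ∀ n, (P n).natDegree = n)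
    (hAB : ∀ i, SatisfiesRecurrence P (A i) (B i)) (h : SatisfiesRecurrence P lam mu)
    (hA : ∀ i n, A i n ≠ 0) (hlam : ∀ n, lam n ≠ 0)
    (h0 : Tendsto (fun i => B i 0) l (𝓝 (mu 0))) (n : ℕ) :
    Tendsto (fun i => A i n) l (𝓝 (lam n)) ∧ Tendsto (fun i => B i n) l (𝓝 (mu n)) := by
  have hc (i) := ((hAB i).coeffs_eq hP hdeg h).1
  have hd (i) := ((hAB i).coeffs_eq hP hdeg h).2
  have hbirth (k : ℕ) (hk : Tendsto (fun i => B i k) l (𝓝 (mu k))) :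
      Tendsto (fun i => A i k) l (𝓝 (lam k)) := by
    have := (tendsto_const_nhds (x := lam k + mu k)).sub hk
    rw [add_sub_cancel_right] at this
    exact this.congr fun i => by linarith [hc i k]
  induction n with
  | zero => exact ⟨hbirth 0 h0, h0⟩
  | succ n ih =>
    have hB : Tendsto (fun i => B i (n + 1)) l (𝓝 (mu (n + 1))) := by
      have := (tendsto_const_nhds (x := lam n * mu (n + 1))).div ih.1 (hlam n)
      rw [mul_div_cancel_left₀ _ (hlam n)] at this
      exact this.congr fun i => by
        rw [Pi.div_apply, ← hd i n, mul_div_cancel_left₀ _ (hA i n)]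
    exact ⟨hbirth _ hB, hB⟩

end Recurrence

/-! ### Moment functionals of measures -/

section PolyIntegral

variable {χ : Measure ℝ}

lemma integrable_eval (h : ∀ n : ℕ, Integrable (fun x : ℝ => x ^ n) χ) (p : ℝ[X]) :
    Integrable (fun x => p.eval x) χ := by
  simp_rw [eval_eq_sum_range]
  exact integrable_finsetSum _ fun i _ => (h i).const_mul _

/-- Integration of polynomials as a linear functional. -/
noncomputable def polyIntegral (χ : Measure ℝ) (h : ∀ n : ℕ, Integrable (fun x : ℝ => x ^ n) χ) :
    ℝ[X] →ₗ[ℝ] ℝ where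
  toFun p := ∫ x, p.eval x ∂χ
  map_add' p q := by
    simp_rw [eval_add]
    exact integral_add (integrable_eval h p) (integrable_eval h q)
  map_smul' c p := by
    simp_rw [eval_smul, smul_eq_mul, RingHom.id_apply]
    exact integral_const_mul _ _

variable (h : ∀ n : ℕ, Integrable (fun x : ℝ => x ^ n) χ)

lemma polyIntegral_apply (p : ℝ[X]) : polyIntegral χ h p = ∫ x, p.eval x ∂χ := rfl

/-- Pairwise orthogonality extends to all lower degrees by stripping the top coefficient of `q` with
`P k`. -/
lemma IsMonicOPS.isOrthPoly {P : ℕ → ℝ[X]} (hP : IsMonicOPS χ P) (n : ℕ) :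
    IsOrthPoly (polyIntegral χ h) n (P n) := by
  refine ⟨hP.monic n, hP.natDegree_eq n, ?_⟩
  have key (k : ℕ) : k ≤ n → ∀ q : ℝ[X], q.degree < k → polyIntegral χ h (P n * q) = 0 := by
    induction k with
    | zero =>
      intro _ q hq
      have : q = 0 := by
        ext m
        exact (degree_lt_iff_coeff_zero _ _).1 hq m m.zero_le
      rw [this, mul_zero, map_zero]
    | succ k ih =>
      intro hk q hq
      have hdeg : (q - C (q.coeff k) * P k).degree < k := by
        refine (degree_lt_iff_coeff_zero _ _).2 fun m hm => ?_
        rcases hm.eq_or_lt with rfl | hm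
        · have := (hP.monic k).coeff_natDegree
          rw [hP.natDegree_eq k] at this
          simp [this]
        · rw [coeff_sub, coeff_C_mul, (degree_lt_iff_coeff_zero _ _).1 hq m hm,
            coeff_eq_zero_of_natDegree_lt ((hP.natDegree_eq k).trans_lt hm), mul_zero, sub_zero]
      have h0 : polyIntegral χ h (P n * P k) = 0 := by
        simp_rw [polyIntegral_apply, eval_mul]
        exact hP.orthogonal n k (by omega)
      have h1 := ih (by omega) _ hdeg
      rw [mul_sub, map_sub, mul_left_comm, ← smul_eq_C_mul, map_smul, h0, smul_zero,
        sub_zero] at h1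
      exact h1
  exact key n le_rfl

lemma isMonicOPS_of_isOrthPoly {P : ℕ → ℝ[X]}
    (hP : ∀ n, IsOrthPoly (polyIntegral χ h) n (P n)) : IsMonicOPS χ P := by
  refine ⟨fun n => (hP n).monic, fun n => (hP n).natDegree_eq, fun m n hmn => ?_⟩
  simp_rw [← eval_mul]
  rw [← polyIntegral_apply h]
  rcases hmn.lt_or_gt with hlt | hlt
  · rw [mul_comm]
    exact (hP n).orthogonal _ (by rw [(hP m).degree_eq]; exact_mod_cast hlt)
  · exact (hP m).orthogonal _ (by rw [(hP n).degree_eq]; exact_mod_cast hlt)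

/-- A zero integral would concentrate `χ` on the finite, hence closed, root set of `p`, which would
then contain the support. -/
lemma polyIntegral_pos (hinf : χ.support.Infinite) {p : ℝ[X]} (hp : p ≠ 0)
    (hnonneg : ∀ᵐ x ∂χ, 0 ≤ p.eval x) : 0 < polyIntegral χ h p := by
  rw [polyIntegral_apply]
  refine (integral_nonneg_of_ae hnonneg).lt_of_ne fun h0 => hinf ?_
  have hae := (integral_eq_zero_iff_of_nonneg_ae hnonneg (integrable_eval h p)).1 h0.symm
  have hfin : {x : ℝ | p.IsRoot x}.Finite := finite_setOfPred_isRoot hp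
  exact hfin.subset (Measure.support_subset_of_isClosed hfin.isClosed hae)

lemma isPosDef_polyIntegral (hinf : χ.support.Infinite) : IsPosDef (polyIntegral χ h) :=
  fun p hp => polyIntegral_pos h hinf (mul_ne_zero hp hp) <| .of_forall fun x => by
    rw [eval_mul]
    exact mul_self_nonneg _

lemma isPosDef_mulX_polyIntegral (hinf : χ.support.Infinite) (hsupp : χ (Set.Iio 0) = 0) :
    IsPosDef (mulX (polyIntegral χ h)) := fun p hp => by
  rw [mulX_apply]
  refine polyIntegral_pos h hinf (mul_ne_zero X_ne_zero (mul_ne_zero hp hp)) ?_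
  have : ∀ᵐ x ∂χ, 0 ≤ x := by
    rw [ae_iff]
    simpa [Set.Iio] using hsupp
  filter_upwards [this] with x hx
  rw [eval_mul, eval_mul, eval_X]
  exact mul_nonneg hx (mul_self_nonneg _)

end PolyIntegral

/-! ### Rescaled functionals -/

section Smul

variable {L : ℝ[X] →ₗ[ℝ] ℝ} {c : ℝ}

lemma IsPosDef.smul (hL : IsPosDef L) (hc : 0 < c) : IsPosDef (c • L) :=
  fun p hp => mul_pos hc (hL p hp)

lemma IsOrthPoly.smul {n : ℕ} {p : ℝ[X]} (hp : IsOrthPoly L n p) (c : ℝ) :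
    IsOrthPoly (c • L) n p :=
  ⟨hp.monic, hp.natDegree_eq, fun q hq => by
    rw [LinearMap.smul_apply, hp.orthogonal q hq, smul_zero]⟩

end Smul

/-! ### The measures `φ⁽ᵃ⁾` and their moments -/

section Phi

variable {ψ : Measure ℝ}

lemma restrict_Ici_eq (hsupp : ψ (Set.Iio 0) = 0) : ψ.restrict (Set.Ici 0) = ψ :=
  Measure.restrict_eq_self_of_ae_mem <| by
    rw [ae_iff]
    simpa [Set.Iio] using hsupp

/-- Since `1 / 0 = ∞`, finiteness of `m₋₁` rules out an atom at `0`. -/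
lemma ae_pos (hsupp : ψ (Set.Iio 0) = 0) (hm : mNegOne ψ < ⊤) : ∀ᵐ x ∂ψ, 0 < x := by
  rw [mNegOne, restrict_Ici_eq hsupp] at hm
  filter_upwards [ae_lt_top (by fun_prop) hm.ne] with x hx
  simpa using hx

lemma mNegOne_pos [IsProbabilityMeasure ψ] (hsupp : ψ (Set.Iio 0) = 0) : 0 < mNegOne ψ := by
  rw [mNegOne, restrict_Ici_eq hsupp, lintegral_pos_iff_support (by fun_prop)]
  have : Function.support (fun x : ℝ => (ENNReal.ofReal x)⁻¹) = Set.univ := by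
    ext x
    simp
  simp [this]

lemma phiZero_univ [IsProbabilityMeasure ψ] (hsupp : ψ (Set.Iio 0) = 0) (hm : mNegOne ψ < ⊤) :
    phiZero ψ Set.univ = 1 := by
  rw [phiZero, Measure.smul_apply, withDensity_apply _ MeasurableSet.univ, Measure.restrict_univ,
    smul_eq_mul]
  exact ENNReal.inv_mul_cancel (mNegOne_pos hsupp).ne' hm.ne

lemma isProbabilityMeasure_phi [IsProbabilityMeasure ψ] (hsupp : ψ (Set.Iio 0) = 0)
    (hm : mNegOne ψ < ⊤) (a : ℝ≥0) : IsProbabilityMeasure (phi ψ a) := by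
  constructor
  rw [phi, Measure.smul_apply, Measure.add_apply, Measure.smul_apply, phiZero_univ hsupp hm,
    measure_univ, smul_eq_mul, smul_eq_mul, mul_one]
  exact ENNReal.inv_mul_cancel (by simp) (by simp)

lemma integrable_id_mul_phiZero (hsupp : ψ (Set.Iio 0) = 0) (hm : mNegOne ψ < ⊤)
    [IsProbabilityMeasure ψ] {f : ℝ → ℝ} (hf : Integrable f ψ) :
    Integrable (fun x => x * f x) (phiZero ψ) := by
  have hlt : ∀ᵐ x ∂ψ, (ENNReal.ofReal x)⁻¹ < ⊤ := by
    filter_upwards [ae_pos hsupp hm] with x hx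
    simpa using hx
  rw [phiZero, restrict_Ici_eq hsupp]
  refine Integrable.smul_measure ?_ (by simpa using (mNegOne_pos hsupp).ne')
  rw [integrable_withDensity_iff_integrable_smul' (by fun_prop) hlt]
  refine hf.congr ?_
  filter_upwards [ae_pos hsupp hm] with x hx
  rw [ENNReal.toReal_inv, ENNReal.toReal_ofReal hx.le, smul_eq_mul, inv_mul_cancel_left₀ hx.ne']

lemma integral_id_mul_phiZero (hsupp : ψ (Set.Iio 0) = 0) (hm : mNegOne ψ < ⊤) (f : ℝ → ℝ) :
    ∫ x, x * f x ∂(phiZero ψ) = (mNegOne ψ).toReal⁻¹ * ∫ x, f x ∂ψ := by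
  have hlt : ∀ᵐ x ∂ψ, (ENNReal.ofReal x)⁻¹ < ⊤ := by
    filter_upwards [ae_pos hsupp hm] with x hx
    simpa using hx
  rw [phiZero, restrict_Ici_eq hsupp, integral_smul_measure,
    integral_withDensity_eq_integral_toReal_smul (by fun_prop) hlt, ENNReal.toReal_inv,
    smul_eq_mul]
  congr 1
  refine integral_congr_ae ?_
  filter_upwards [ae_pos hsupp hm] with x hx
  rw [ENNReal.toReal_inv, ENNReal.toReal_ofReal hx.le, smul_eq_mul, inv_mul_cancel_left₀ hx.ne']

lemma integrable_pow_phiZero (hψ : IsMomentMeasure ψ) (hsupp : ψ (Set.Iio 0) = 0)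
    (hm : mNegOne ψ < ⊤) (n : ℕ) : Integrable (fun x : ℝ => x ^ n) (phiZero ψ) := by
  have := hψ.isProbabilityMeasure
  have : IsFiniteMeasure (phiZero ψ) := ⟨by simp [phiZero_univ hsupp hm]⟩
  cases n with
  | zero => simp
  | succ n =>
    simp_rw [pow_succ']
    exact integrable_id_mul_phiZero hsupp hm (hψ.integrable_pow n)

lemma integrable_pow_phi (hψ : IsMomentMeasure ψ) (hsupp : ψ (Set.Iio 0) = 0)
    (hm : mNegOne ψ < ⊤) (a : ℝ≥0) (n : ℕ) : Integrable (fun x : ℝ => x ^ n) (phi ψ a) :=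
  Integrable.smul_measure (((integrable_dirac (by simp)).smul_measure (by simp)).add_measure
    (integrable_pow_phiZero hψ hsupp hm n)) (by simp)

/-- The factor `x` annihilates `δ₀` and cancels the density `x⁻¹`; only the normalizing constants
remain. -/
lemma integral_id_mul_phi (hψ : IsMomentMeasure ψ) (hsupp : ψ (Set.Iio 0) = 0)
    (hm : mNegOne ψ < ⊤) (a : ℝ≥0) {f : ℝ → ℝ} (hf : Integrable f ψ) :
    ∫ x, x * f x ∂(phi ψ a) = 1 / ((a + 1) * (mNegOne ψ).toReal) * ∫ x, f x ∂ψ := by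
  have := hψ.isProbabilityMeasure
  rw [phi, integral_smul_measure, integral_add_measure
    ((integrable_dirac (by simp)).smul_measure (by simp)) (integrable_id_mul_phiZero hsupp hm hf),
    integral_smul_measure, integral_dirac, integral_id_mul_phiZero hsupp hm, ENNReal.toReal_inv,
    ENNReal.toReal_add (by simp) (by simp)]
  simp
  ring

/-- The moment functional of `ψ` is, up to a positive factor, that of `x φ⁽ᵃ⁾(dx)`. -/
lemma mulX_polyIntegral_phi (hψ : IsMomentMeasure ψ) (hsupp : ψ (Set.Iio 0) = 0)
    (hm : mNegOne ψ < ⊤) (a : ℝ≥0) :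
    mulX (polyIntegral (phi ψ a) (integrable_pow_phi hψ hsupp hm a)) =
      (1 / ((a + 1) * (mNegOne ψ).toReal)) • polyIntegral ψ hψ.integrable_pow := by
  refine LinearMap.ext fun p => ?_
  rw [mulX_apply, LinearMap.smul_apply, polyIntegral_apply, polyIntegral_apply, smul_eq_mul,
    ← integral_id_mul_phi hψ hsupp hm a (integrable_eval hψ.integrable_pow p)]
  simp

lemma mNegOne_factor_pos (hψ : IsMomentMeasure ψ) (hsupp : ψ (Set.Iio 0) = 0)
    (hm : mNegOne ψ < ⊤) (a : ℝ≥0) : 0 < 1 / ((a + 1) * (mNegOne ψ).toReal) := by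
  have := hψ.isProbabilityMeasure
  have := ENNReal.toReal_pos (mNegOne_pos hsupp).ne' hm.ne
  positivity

/-- If `p * p` had zero integral, it would vanish `φ⁽ᵃ⁾`-a.e., and so would `x * p * p`,
contradicting positive definiteness for `ψ`. This avoids computing the support of `φ⁽ᵃ⁾`. -/
lemma isPosDef_polyIntegral_phi (hψ : IsMomentMeasure ψ) (hsupp : ψ (Set.Iio 0) = 0)
    (hm : mNegOne ψ < ⊤) (a : ℝ≥0) :
    IsPosDef (polyIntegral (phi ψ a) (integrable_pow_phi hψ hsupp hm a)) := fun p hp => by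
  have hnn : 0 ≤ fun x => (p * p).eval x := fun x => by
    simp only [Pi.zero_apply, eval_mul]
    exact mul_self_nonneg _
  refine (integral_nonneg hnn).lt_of_ne fun h0 => ?_
  have hae := (integral_eq_zero_iff_of_nonneg hnn
    (integrable_eval (integrable_pow_phi hψ hsupp hm a) _)).1 h0.symm
  have hpos := (isPosDef_polyIntegral hψ.integrable_pow hψ.infinite_support).smul
    (mNegOne_factor_pos hψ hsupp hm a) p hp
  rw [← mulX_polyIntegral_phi hψ hsupp hm a, mulX_apply, polyIntegral_apply] at hpos
  refine hpos.ne' (integral_eq_zero_of_ae ?_)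
  filter_upwards [hae] with x hx
  rw [eval_mul, hx]
  simp

end Phi

/-! ### Shell rates, their limit and duality -/

section ShellRates

variable {ψ : Measure ℝ}

lemma exists_isMonicOPS (hψ : IsMomentMeasure ψ) : ∃ T : ℕ → ℝ[X], IsMonicOPS ψ T := by
  choose T hT using (isPosDef_polyIntegral hψ.integrable_pow hψ.infinite_support).exists_isOrthPoly
  exact ⟨T, isMonicOPS_of_isOrthPoly _ hT⟩

/-- The shell rates exist, and the dual rates are rates for the orthogonal polynomials of `ψ`. -/
lemma exists_isShellRates (hψ : IsMomentMeasure ψ) (hsupp : ψ (Set.Iio 0) = 0)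
    (hm : mNegOne ψ < ⊤) {T : ℕ → ℝ[X]} (hT : IsMonicOPS ψ T) (a : ℝ≥0) :
    ∃ lam mu : ℕ → ℝ, IsShellRates ψ a lam mu ∧
      SatisfiesRecurrence T (fun n => mu (n + 1)) lam ∧
      lam 0 = 1 / ((a + 1) * (mNegOne ψ).toReal) := by
  have := hψ.isProbabilityMeasure
  have := isProbabilityMeasure_phi hsupp hm a
  have hL := isPosDef_polyIntegral_phi hψ hsupp hm a
  have hX := mulX_polyIntegral_phi hψ hsupp hm a
  obtain ⟨S, hS⟩ := Classical.axiomOfChoice hL.exists_isOrthPoly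
  obtain ⟨lam, mu, hlam, hmu0, hmu, hlam0, hrS, hrT⟩ := exists_dual_rates hL
    (hX ▸ (isPosDef_polyIntegral hψ.integrable_pow hψ.infinite_support).smul
      (mNegOne_factor_pos hψ hsupp hm a)) hS
    (fun n => hX ▸ (hT.isOrthPoly hψ.integrable_pow n).smul _)
  refine ⟨lam, mu, ⟨⟨⟨hlam, hmu0.ge, hmu⟩, S, isMonicOPS_of_isOrthPoly _ hS, hrS⟩, hmu0⟩, hrT, ?_⟩
  have h1 : polyIntegral (phi ψ a) (integrable_pow_phi hψ hsupp hm a) 1 = 1 := by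
    simp [polyIntegral_apply]
  have h2 : polyIntegral ψ hψ.integrable_pow 1 = 1 := by
    simp [polyIntegral_apply]
  have h3 := LinearMap.congr_fun hX 1
  rw [mulX_apply, mul_one, LinearMap.smul_apply, h2, smul_eq_mul, mul_one] at h3
  rw [hlam0, h1, h3, div_one]

lemma IsShellRates.unique (hψ : IsMomentMeasure ψ) (hsupp : ψ (Set.Iio 0) = 0)
    (hm : mNegOne ψ < ⊤) {a : ℝ≥0} {lam mu lam' mu' : ℕ → ℝ} (h : IsShellRates ψ a lam mu)
    (h' : IsShellRates ψ a lam' mu') : lam = lam' ∧ mu = mu' := by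
  obtain ⟨⟨hr, P, hP, hrec⟩, h0⟩ := h
  obtain ⟨⟨-, P', hP', hrec'⟩, h0'⟩ := h'
  obtain rfl : P = P' := funext fun n => (isPosDef_polyIntegral_phi hψ hsupp hm a).eq_of_isOrthPoly
    (hP.isOrthPoly _ n) (hP'.isOrthPoly _ n)
  exact hrec.rates_eq hP.monic hP.natDegree_eq hrec' (fun n => (hr.birth_pos n).ne')
    (h0.trans h0'.symm)

/-- By uniqueness, arbitrary shell rates inherit what is known of the constructed ones. -/
lemma IsShellRates.dual (hψ : IsMomentMeasure ψ) (hsupp : ψ (Set.Iio 0) = 0)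
    (hm : mNegOne ψ < ⊤) {a : ℝ≥0} {lam mu : ℕ → ℝ} (h : IsShellRates ψ a lam mu) {T : ℕ → ℝ[X]}
    (hT : IsMonicOPS ψ T) : SatisfiesRecurrence T (fun n => mu (n + 1)) lam ∧
      lam 0 = 1 / ((a + 1) * (mNegOne ψ).toReal) := by
  obtain ⟨lam', mu', h', hrec⟩ := exists_isShellRates hψ hsupp hm hT a
  obtain ⟨rfl, rfl⟩ := h.unique hψ hsupp hm h'
  exact hrec

lemma IsShellRatesLimit.unique (hψ : IsMomentMeasure ψ) (hsupp : ψ (Set.Iio 0) = 0)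
    (hm : mNegOne ψ < ⊤) {lam mu lam' mu' : ℕ → ℝ} (h : IsShellRatesLimit ψ lam mu)
    (h' : IsShellRatesLimit ψ lam' mu') : lam = lam' ∧ mu = mu' := by
  obtain ⟨L, M, hLM, hlim⟩ := h
  obtain ⟨L', M', hLM', hlim'⟩ := h'
  obtain rfl : L = L' := funext fun a => ((hLM a).unique hψ hsupp hm (hLM' a)).1
  obtain rfl : M = M' := funext fun a => ((hLM a).unique hψ hsupp hm (hLM' a)).2
  exact ⟨funext fun n => tendsto_nhds_unique (hlim n).1 (hlim' n).1,
    funext fun n => tendsto_nhds_unique (hlim n).2 (hlim' n).2⟩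

/-- The shell rates converge as `a → ∞`, to the dual of the rates of `ψ` without killing. -/
lemma exists_isShellRatesLimit (hψ : IsMomentMeasure ψ) (hsupp : ψ (Set.Iio 0) = 0)
    (hm : mNegOne ψ < ⊤) {T : ℕ → ℝ[X]} (hT : IsMonicOPS ψ T) :
    ∃ lam mu : ℕ → ℝ, IsShellRatesLimit ψ lam mu ∧
      IsRateSet (fun n => mu (n + 1)) lam ∧ SatisfiesRecurrence T (fun n => mu (n + 1)) lam ∧
      lam 0 = 0 := by
  have hL := isPosDef_polyIntegral hψ.integrable_pow hψ.infinite_support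
  have hL' := isPosDef_mulX_polyIntegral hψ.integrable_pow hψ.infinite_support hsupp
  obtain ⟨U, hU⟩ := Classical.axiomOfChoice hL'.exists_isOrthPoly
  obtain ⟨A, B, hA, hB0, hB, -, hrec, -⟩ := exists_dual_rates hL hL'
    (hT.isOrthPoly hψ.integrable_pow) hU
  choose L M hLM hLMrec hL0 using exists_isShellRates hψ hsupp hm hT
  -- `A`, `B` are the rates of `ψ` with `B 0 = 0`. Undoing the duality, the limiting births are `B`
  -- and the limiting deaths are `A` shifted by one, with `0` in front.
  refine ⟨B, fun n => Nat.casesOn n 0 A, ⟨L, M, hLM, fun n => ?_⟩, ⟨hA, hB0.ge, hB⟩, hrec, hB0⟩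
  have h0 : Tendsto (fun a => L a 0) atTop (𝓝 (B 0)) := by
    have h1 : Tendsto (fun a : ℝ≥0 => (a : ℝ) + 1) atTop atTop :=
      tendsto_atTop_add_const_right _ _ (NNReal.tendsto_coe_atTop.2 tendsto_id)
    have h2 := h1.inv_tendsto_atTop.mul_const (mNegOne ψ).toReal⁻¹
    rw [zero_mul, ← hB0] at h2
    refine h2.congr fun a => ?_
    rw [hL0, one_div, mul_inv, Pi.inv_apply]
  have hlim := SatisfiesRecurrence.tendsto_rates hT.monic hT.natDegree_eq hLMrec hrec
    (fun a n => ((hLM a).1.1.death_succ_pos n).ne') (fun n => (hA n).ne') h0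
  refine ⟨(hlim n).2, ?_⟩
  cases n with
  | zero => exact tendsto_const_nhds.congr fun a => (hLM a).2.symm
  | succ n => exact (hlim n).1

lemma existsUnique_isExtShellRates (hψ : IsMomentMeasure ψ) (hsupp : ψ (Set.Iio 0) = 0)
    (hm : mNegOne ψ < ⊤) (a : ℝ≥0∞) :
    ∃! r : (ℕ → ℝ) × (ℕ → ℝ), IsExtShellRates ψ a r.1 r.2 := by
  obtain ⟨T, hT⟩ := exists_isMonicOPS hψ
  induction a with
  | top =>
    obtain ⟨lam, mu, h, -⟩ := exists_isShellRatesLimit hψ hsupp hm hT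
    refine ⟨(lam, mu), .inr ⟨rfl, h⟩, ?_⟩
    rintro ⟨lam', mu'⟩ (⟨b, hb, -⟩ | ⟨-, h'⟩)
    · exact absurd hb ENNReal.top_ne_coe
    · exact Prod.ext_iff.2 (h'.unique hψ hsupp hm h)
  | coe a =>
    obtain ⟨lam, mu, h, -⟩ := exists_isShellRates hψ hsupp hm hT a
    refine ⟨(lam, mu), .inl ⟨a, rfl, h⟩, ?_⟩
    rintro ⟨lam', mu'⟩ (⟨b, hb, h'⟩ | ⟨ha, -⟩)
    · obtain rfl := ENNReal.coe_injective hb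
      exact Prod.ext_iff.2 (h'.unique hψ hsupp hm h)
    · exact absurd ha ENNReal.coe_ne_top

lemma existsUnique_isDeterminedBy (hψ : IsMomentMeasure ψ) (hsupp : ψ (Set.Iio 0) = 0)
    (hm : mNegOne ψ < ⊤) (a : ℝ≥0∞) :
    ∃! r : (ℕ → ℝ) × (ℕ → ℝ), IsDeterminedBy ψ a r.1 r.2 := by
  obtain ⟨⟨lam, mu⟩, h, huniq⟩ := existsUnique_isExtShellRates hψ hsupp hm a
  refine ⟨(fun n => mu (n + 1), lam), ⟨lam, mu, h, fun _ => rfl, fun _ => rfl⟩, ?_⟩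
  rintro ⟨lam', mu'⟩ ⟨A, B, hAB, h1, h2⟩
  obtain ⟨rfl, rfl⟩ := Prod.ext_iff.1 (huniq (A, B) hAB)
  exact Prod.ext (funext h1) (funext h2)

lemma IsDeterminedBy.isRateSetOf (hψ : IsMomentMeasure ψ) (hsupp : ψ (Set.Iio 0) = 0)
    (hm : mNegOne ψ < ⊤) {a : ℝ≥0∞} {lam mu : ℕ → ℝ} (h : IsDeterminedBy ψ a lam mu) :
    IsRateSetOf ψ lam mu ∧ mu 0 = (1 / ((a + 1) * mNegOne ψ)).toReal := by
  obtain ⟨T, hT⟩ := exists_isMonicOPS hψ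
  obtain ⟨A, B, hAB, h1, h2⟩ := h
  obtain rfl : lam = fun n => B (n + 1) := funext h1
  obtain rfl : mu = A := funext h2
  rcases hAB with ⟨b, rfl, hb⟩ | ⟨rfl, hlim⟩
  · obtain ⟨hrec, h0⟩ := hb.dual hψ hsupp hm hT
    refine ⟨⟨⟨hb.1.1.death_succ_pos, (hb.1.1.birth_pos 0).le, fun n => hb.1.1.birth_pos _⟩, T, hT,
      hrec⟩, ?_⟩
    rw [h0, ENNReal.toReal_div, ENNReal.toReal_mul, ENNReal.toReal_add (by simp) (by simp)]
    simp
  · obtain ⟨lam', mu', h', hr, hrec, h0⟩ := exists_isShellRatesLimit hψ hsupp hm hT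
    obtain ⟨rfl, rfl⟩ := hlim.unique hψ hsupp hm h'
    refine ⟨⟨hr, T, hT, hrec⟩, ?_⟩
    have := hψ.isProbabilityMeasure
    rw [h0, top_add, ENNReal.top_mul (mNegOne_pos hsupp).ne']
    simp

end ShellRates

end BirthDeath

/-! ### The range of the initial death rate -/

theorem theorem2p1 (ψ : Measure ℝ) (hψ : BirthDeath.IsMomentMeasure ψ)
    (hsupp : ψ (Set.Iio 0) = 0) (hnat : BirthDeath.IsNatural ψ)
    (hm : BirthDeath.mNegOne ψ < ⊤) :
    -- the parameter `a` determines the shell rates, and hence (by duality) `lam` and `mu`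
    (∀ a : ℝ≥0∞, ∃! r : (ℕ → ℝ) × (ℕ → ℝ), BirthDeath.IsExtShellRates ψ a r.1 r.2) ∧
    (∀ a : ℝ≥0∞, ∃! r : (ℕ → ℝ) × (ℕ → ℝ), BirthDeath.IsDeterminedBy ψ a r.1 r.2) ∧
    -- these are rate sets of `ψ`, and `mu 0` is given by the explicit formula
    (∀ (a : ℝ≥0∞) (lam mu : ℕ → ℝ), BirthDeath.IsDeterminedBy ψ a lam mu →
      BirthDeath.IsRateSetOf ψ lam mu ∧
      mu 0 = (1 / ((a + 1) * BirthDeath.mNegOne ψ)).toReal) ∧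
    -- the values of `mu 0` fill the whole interval
    {x : ℝ | ∃ (a : ℝ≥0∞) (lam mu : ℕ → ℝ), BirthDeath.IsDeterminedBy ψ a lam mu ∧ x = mu 0} =
      Set.Icc 0 (1 / (BirthDeath.mNegOne ψ).toReal) := by
  have := hψ.isProbabilityMeasure
  have hmpos := ENNReal.toReal_pos (BirthDeath.mNegOne_pos hsupp).ne' hm.ne
  refine ⟨BirthDeath.existsUnique_isExtShellRates hψ hsupp hm,
    BirthDeath.existsUnique_isDeterminedBy hψ hsupp hm,
    fun a lam mu h => h.isRateSetOf hψ hsupp hm, Set.Subset.antisymm ?_ fun x hx => ?_⟩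
  · rintro _ ⟨a, lam, mu, h, rfl⟩
    rw [(h.isRateSetOf hψ hsupp hm).2]
    refine ⟨ENNReal.toReal_nonneg, ?_⟩
    rw [← ENNReal.toReal_one, ← ENNReal.toReal_div]
    refine ENNReal.toReal_mono (by simpa using (BirthDeath.mNegOne_pos hsupp).ne') ?_
    gcongr
    exact le_mul_of_one_le_left' le_add_self
  · obtain ⟨a, ha⟩ : ∃ a : ℝ≥0∞, x = (1 / ((a + 1) * BirthDeath.mNegOne ψ)).toReal := by
      rcases hx.1.eq_or_lt with rfl | hpos
      · refine ⟨⊤, ?_⟩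
        rw [top_add, ENNReal.top_mul (BirthDeath.mNegOne_pos hsupp).ne']
        simp
      · have h1 : 0 ≤ 1 / (x * (BirthDeath.mNegOne ψ).toReal) - 1 := by
          have := (le_div_iff₀ hmpos).1 hx.2
          rw [sub_nonneg]
          exact (one_le_div (by positivity)).2 this
        -- This solves `x = 1 / ((a + 1) m₋₁)` for `a`; by `h1`, `ENNReal.ofReal` does not truncate.
        refine ⟨ENNReal.ofReal (1 / (x * (BirthDeath.mNegOne ψ).toReal) - 1), ?_⟩
        rw [ENNReal.toReal_div, ENNReal.toReal_mul, ENNReal.toReal_add (by simp) (by simp),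
          ENNReal.toReal_ofReal h1, ENNReal.toReal_one]
        field_simp
        simp
    obtain ⟨⟨lam, mu⟩, h, -⟩ := BirthDeath.existsUnique_isDeterminedBy hψ hsupp hm a
    exact ⟨a, lam, mu, h, ha.trans (h.isRateSetOf hψ hsupp hm).2.symm⟩
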